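/- Let $M=\mathbb{R}\times\mathbb{R}\times S^2$ with coordinates $(t,\ell,\vartheta,\varphi)$, where $t,\ell\in\mathbb{R}$ and $(\vartheta,\varphi)$ are the usual spherical coordinates on the unit sphere $S^2$, and let $$g=-N(\ell,\vartheta)^2\,dt^2+d\ell^2+R(\ell,\vartheta)^2\big[d\vartheta^2+\sin^2\vartheta\,(d\varphi-\omega(\ell,\vartheta)\,dt)^2\big],$$ where $N,R,\omega$ are functions of $(\ell,\vartheta)\in\mathbb{R}\times[0,\pi]$ that define smooth functions on $\mathbb{R}\times S^2$, where $N$ and $R$ are strictly positive, and where, for $\ell\to\pm\infty$, uniformly in $\vartheta$, $$N=1+O(1/|\ell|),\qquad R=|\ell|\,\big(1+O(1/|\ell|)\big),\qquad \omega=O(1/|\ell|^2).$$ Then the spacetime $(M,g)$, time-oriented by $dt$ (so that a causal vector $v$ is future-directed if $dt(v)>0$), is globally hyperbolic, i.e., it possesses a Cauchy hypersurface: there is a closed subset of $M$ that is met exactly once by every inextendible piecewise $C^1$ causal curve. -/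

import Mathlib

open Set Filter Topology Bundle Asymptotics
open scoped Manifold ContDiff

noncomputable section

/-! ### Spacetimes, causal curves, global hyperbolicity -/

section Spacetime

variable {E : Type*} [NormedAddCommGroup E] [NormedSpace ℝ E]
  {H : Type*} [TopologicalSpace H] (I : ModelWithCorners ℝ E H)
  (M : Type*) [TopologicalSpace M] [ChartedSpace H M] [IsManifold I ∞ M]

/-- A time-oriented Lorentzian manifold of signature `(-, +, ..., +)` with smooth metric `inner`.
The time orientation is given by a continuous one-form `timeForm` that does not vanish on any
causal vector (the metric dual of minus a timelike vector field); a causal vector `v` is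
future-directed if `timeForm v > 0`. -/
structure SpacetimeStructure where
  /-- The metric tensor. -/
  inner (p : M) : TangentSpace I p →L[ℝ] TangentSpace I p →L[ℝ] ℝ
  symm (p : M) (v w : TangentSpace I p) : inner p v w = inner p w v
  /-- Each tangent space is the orthogonal sum of a negative line and a positive hyperplane. -/
  signature (p : M) : ∃ u : TangentSpace I p, inner p u u < 0 ∧
    ∀ v : TangentSpace I p, inner p u v = 0 → v ≠ 0 → 0 < inner p v v
  contMDiff : ContMDiff I (I.prod 𝓘(ℝ, E →L[ℝ] E →L[ℝ] ℝ)) ∞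
    (fun p ↦ TotalSpace.mk' (E →L[ℝ] E →L[ℝ] ℝ) p (inner p))
  /-- The one-form that defines the time orientation. -/
  timeForm (p : M) : TangentSpace I p →L[ℝ] ℝ
  timeForm_ne_zero (p : M) (v : TangentSpace I p) :
    v ≠ 0 → inner p v v ≤ 0 → timeForm p v ≠ 0
  timeForm_continuous : Continuous (fun p ↦ TotalSpace.mk' (E →L[ℝ] ℝ) p (timeForm p))

variable {I M}

namespace SpacetimeStructure

/-- A tangent vector is future-directed causal if it is non-zero, timelike or lightlike, and
positive with respect to the time orientation. -/
def IsFutureCausal (g : SpacetimeStructure I M) (p : M) (v : TangentSpace I p) : Prop :=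
  v ≠ 0 ∧ g.inner p v v ≤ 0 ∧ 0 < g.timeForm p v

/-- Future-directed, piecewise `C¹` causal curves, parametrized by the real line (every open
interval is diffeomorphic to it): the curve is continuous and, away from a set of break points
that has finitely many elements in every bounded interval, it is `C¹` with future-directed causal
velocity. (Nothing is required of the one-sided derivatives at break points.) -/
def IsFutureCausalCurve (g : SpacetimeStructure I M) (γ : ℝ → M) : Prop :=
  Continuous γ ∧
    ∃ B : Set ℝ, (∀ a b : ℝ, (B ∩ Icc a b).Finite) ∧
      ∀ s ∉ B, ContMDiffAt 𝓘(ℝ, ℝ) I 1 γ s ∧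
        g.IsFutureCausal (γ s) (mfderiv 𝓘(ℝ, ℝ) I γ s (1 : ℝ))

end SpacetimeStructure

/-- A curve is inextendible if it has neither a past nor a future endpoint. -/
def IsInextendibleCurve {M : Type*} [TopologicalSpace M] (γ : ℝ → M) : Prop :=
  (¬ ∃ p : M, Tendsto γ atTop (𝓝 p)) ∧ (¬ ∃ p : M, Tendsto γ atBot (𝓝 p))

namespace SpacetimeStructure

/-- A Cauchy hypersurface is a closed subset that is met exactly once by every inextendible
causal curve. -/
def IsCauchyHypersurface (g : SpacetimeStructure I M) (S : Set M) : Prop :=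
  IsClosed S ∧ ∀ γ : ℝ → M, g.IsFutureCausalCurve γ → IsInextendibleCurve γ → ∃! s : ℝ, γ s ∈ S

/-- A spacetime is globally hyperbolic if it possesses a Cauchy hypersurface. -/
def IsGloballyHyperbolic (g : SpacetimeStructure I M) : Prop :=
  ∃ S : Set M, g.IsCauchyHypersurface S

end SpacetimeStructure

end Spacetime

section Pullback

variable {E : Type*} [NormedAddCommGroup E] [NormedSpace ℝ E]
  {H : Type*} [TopologicalSpace H] {I : ModelWithCorners ℝ E H}
  {M : Type*} [TopologicalSpace M] [ChartedSpace H M] [IsManifold I ∞ M]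
  {V : Type*} [NormedAddCommGroup V] [NormedSpace ℝ V]

/-- The pullback of a bilinear form along a linear map. -/
def pullbackForm {T : Type*} [AddCommGroup T] [Module ℝ T] [TopologicalSpace T]
    [IsTopologicalAddGroup T] [ContinuousSMul ℝ T]
    (b : V →L[ℝ] V →L[ℝ] ℝ) (D : T →L[ℝ] V) : T →L[ℝ] T →L[ℝ] ℝ :=
  (ContinuousLinearMap.precomp ℝ D).comp (b.comp D)

@[simp] theorem pullbackForm_apply {T : Type*} [AddCommGroup T] [Module ℝ T] [TopologicalSpace T]
    [IsTopologicalAddGroup T] [ContinuousSMul ℝ T]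
    (b : V →L[ℝ] V →L[ℝ] ℝ) (D : T →L[ℝ] V) (v w : T) :
    pullbackForm b D v w = b (D v) (D w) := rfl

theorem contMDiffAt_mvfderiv_symmL {f : M → V} (hf : ContMDiff I 𝓘(ℝ, V) ∞ f) (x₀ : M) :
    ContMDiffAt I 𝓘(ℝ, E →L[ℝ] V) ∞
      (fun p ↦ (mvfderiv I f p).comp ((trivializationAt E (TangentSpace I) x₀).symmL ℝ p)) x₀ := by
  have h := ContMDiffAt.mfderiv_const (m := ∞) (n := ∞) (hf x₀) (by simp)
  refine h.congr_of_eventuallyEq ?_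
  filter_upwards with p
  ext v
  simp only [inTangentCoordinates, ContinuousLinearMap.inCoordinates, mvfderiv]
  simp
  rfl

theorem contMDiff_pullbackForm {f : M → V} (hf : ContMDiff I 𝓘(ℝ, V) ∞ f)
    {B : M → V →L[ℝ] V →L[ℝ] ℝ} (hB : ContMDiff I 𝓘(ℝ, V →L[ℝ] V →L[ℝ] ℝ) ∞ B) :
    ContMDiff I (I.prod 𝓘(ℝ, E →L[ℝ] E →L[ℝ] ℝ)) ∞
      (fun p ↦ TotalSpace.mk' (E →L[ℝ] E →L[ℝ] ℝ) p
        (pullbackForm (B p) (mvfderiv I f p))) := by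
  intro x₀
  rw [contMDiffAt_section]
  have hD := contMDiffAt_mvfderiv_symmL hf x₀
  have key : ContMDiffAt I 𝓘(ℝ, E →L[ℝ] E →L[ℝ] ℝ) ∞ (fun p ↦ pullbackForm (B p)
      ((mvfderiv I f p).comp ((trivializationAt E (TangentSpace I) x₀).symmL ℝ p))) x₀ := by
    have h1 := ContMDiffAt.clm_precomp (F₃ := ℝ) hD
    exact h1.clm_comp ((hB x₀).clm_comp hD)
  refine key.congr_of_eventuallyEq ?_
  filter_upwards [(trivializationAt E (TangentSpace I) x₀).open_baseSet.mem_nhds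
    (mem_baseSet_trivializationAt E (TangentSpace I) x₀)] with p hp
  ext v w
  simp only [hom_trivializationAt_apply]
  rw [inCoordinates_apply_eq₂ hp hp (Set.mem_univ _)]
  simp [Trivialization.symmL_apply _ hp]

theorem continuous_mvfderiv {f : M → ℝ} (hf : ContMDiff I 𝓘(ℝ, ℝ) ∞ f) :
    Continuous (fun p ↦ TotalSpace.mk' (E →L[ℝ] ℝ) p
      (mvfderiv I f p : TangentSpace I p →L[ℝ] ℝ)) := by
  have : ContMDiff I (I.prod 𝓘(ℝ, E →L[ℝ] ℝ)) ∞ (fun p ↦ TotalSpace.mk' (E →L[ℝ] ℝ) p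
      (mvfderiv I f p : TangentSpace I p →L[ℝ] ℝ)) := by
    intro x₀
    rw [contMDiffAt_section]
    refine (contMDiffAt_mvfderiv_symmL hf x₀).congr_of_eventuallyEq ?_
    filter_upwards [(trivializationAt E (TangentSpace I) x₀).open_baseSet.mem_nhds
      (mem_baseSet_trivializationAt E (TangentSpace I) x₀)] with p hp
    ext v
    simp only [hom_trivializationAt_apply]
    simp [ContinuousLinearMap.inCoordinates]
  exact this.continuous

end Pullback

/-! ### The wormhole spacetimes -/

instance factFinrankThree : Fact (Module.finrank ℝ (EuclideanSpace ℝ (Fin 3)) = 2 + 1) :=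
  ⟨finrank_euclideanSpace_fin⟩

/-- The unit sphere `S²` in `ℝ³`. -/
abbrev Sphere2 : Type := Metric.sphere (0 : EuclideanSpace ℝ (Fin 3)) 1

/-- The underlying manifold `ℝ × ℝ × S²` with points `(t, ℓ, x)`. -/
abbrev WormholeManifold : Type := ℝ × ℝ × Sphere2

/-- The model with corners of `ℝ × ℝ × S²`. -/
abbrev wormholeModel := 𝓘(ℝ, ℝ).prod (𝓘(ℝ, ℝ).prod (𝓡 2))

/-- The colatitude `ϑ ∈ [0, π]` of a point of the sphere. -/
def colatitude (x : Sphere2) : ℝ := Real.arccos (x.1 2)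

/-- The metric coefficients `N`, `R`, `Ω` (`Ω` is the twist, usually written as a lower-case
omega) of a rotating traversable wormhole, as functions of
`ℓ ∈ ℝ` and `ϑ ∈ [0, π]` (other values of `ϑ` are irrelevant). Regularity, also on the axis,
means that they define smooth functions on `ℝ × S²`; `N` and `R` are strictly positive, and all
three have the prescribed asymptotics for `ℓ → ± ∞`, uniformly in `ϑ`. -/
structure WormholeCoefficients where
  N : ℝ → ℝ → ℝ
  R : ℝ → ℝ → ℝ
  Ω : ℝ → ℝ → ℝ
  smooth_N : ContMDiff (𝓘(ℝ, ℝ).prod (𝓡 2)) 𝓘(ℝ, ℝ) ∞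
    (fun y : ℝ × Sphere2 ↦ N y.1 (colatitude y.2))
  smooth_R : ContMDiff (𝓘(ℝ, ℝ).prod (𝓡 2)) 𝓘(ℝ, ℝ) ∞
    (fun y : ℝ × Sphere2 ↦ R y.1 (colatitude y.2))
  smooth_Ω : ContMDiff (𝓘(ℝ, ℝ).prod (𝓡 2)) 𝓘(ℝ, ℝ) ∞
    (fun y : ℝ × Sphere2 ↦ Ω y.1 (colatitude y.2))
  N_pos : ∀ ℓ : ℝ, ∀ ϑ ∈ Icc 0 Real.pi, 0 < N ℓ ϑ
  R_pos : ∀ ℓ : ℝ, ∀ ϑ ∈ Icc 0 Real.pi, 0 < R ℓ ϑ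
  /-- `N = 1 + O(1/|ℓ|)` -/
  asymp_N : (fun y : ℝ × ℝ ↦ N y.1 y.2 - 1)
    =O[cocompact ℝ ×ˢ 𝓟 (Icc 0 Real.pi)] (fun y ↦ 1 / |y.1|)
  /-- `R = |ℓ| (1 + O(1/|ℓ|))` -/
  asymp_R : (fun y : ℝ × ℝ ↦ R y.1 y.2 / |y.1| - 1)
    =O[cocompact ℝ ×ˢ 𝓟 (Icc 0 Real.pi)] (fun y ↦ 1 / |y.1|)
  /-- `Ω = O(1/|ℓ|²)` -/
  asymp_Ω : (fun y : ℝ × ℝ ↦ Ω y.1 y.2)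
    =O[cocompact ℝ ×ˢ 𝓟 (Icc 0 Real.pi)] (fun y ↦ 1 / |y.1| ^ 2)

/-- The rotation field `∂_φ` about the axis, as a vector field on `ℝ³`. -/
def axialField (x : EuclideanSpace ℝ (Fin 3)) : EuclideanSpace ℝ (Fin 3) := !₂[-x 1, x 0, 0]

/-- The linear map `(τ, l, ξ) ↦ ξ - Ω τ ∂_φ` on `ℝ × ℝ × ℝ³`. -/
def corotating (Ω : ℝ) (x : EuclideanSpace ℝ (Fin 3)) :
    (ℝ × ℝ × EuclideanSpace ℝ (Fin 3)) →L[ℝ] EuclideanSpace ℝ (Fin 3) :=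
  (ContinuousLinearMap.snd ℝ ℝ (EuclideanSpace ℝ (Fin 3))).comp
      (ContinuousLinearMap.snd ℝ ℝ (ℝ × EuclideanSpace ℝ (Fin 3))) -
    (ContinuousLinearMap.fst ℝ ℝ (ℝ × EuclideanSpace ℝ (Fin 3))).smulRight (Ω • axialField x)

/-- The bilinear form `-N² dt² + dℓ² + R² |dx - Ω ∂_φ dt|²` on `ℝ × ℝ × ℝ³`, for given values of
`N`, `R`, `Ω` and a given position `x ∈ ℝ³`. -/
def wormholeForm (N R Ω : ℝ) (x : EuclideanSpace ℝ (Fin 3)) :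
    (ℝ × ℝ × EuclideanSpace ℝ (Fin 3)) →L[ℝ] (ℝ × ℝ × EuclideanSpace ℝ (Fin 3)) →L[ℝ] ℝ :=
  -(N ^ 2) • pullbackForm (ContinuousLinearMap.mul ℝ ℝ)
      (ContinuousLinearMap.fst ℝ ℝ (ℝ × EuclideanSpace ℝ (Fin 3))) +
    pullbackForm (ContinuousLinearMap.mul ℝ ℝ)
      ((ContinuousLinearMap.fst ℝ ℝ (EuclideanSpace ℝ (Fin 3))).comp
        (ContinuousLinearMap.snd ℝ ℝ (ℝ × EuclideanSpace ℝ (Fin 3)))) +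
    R ^ 2 • pullbackForm (innerSL ℝ) (corotating Ω x)

theorem wormholeForm_apply (N R Ω : ℝ) (x : EuclideanSpace ℝ (Fin 3))
    (v w : ℝ × ℝ × EuclideanSpace ℝ (Fin 3)) :
    wormholeForm N R Ω x v w = -(N ^ 2) * (v.1 * w.1) + v.2.1 * w.2.1 +
      R ^ 2 * inner ℝ (v.2.2 - (v.1 * Ω) • axialField x) (w.2.2 - (w.1 * Ω) • axialField x) := by
  have h (u : ℝ × ℝ × EuclideanSpace ℝ (Fin 3)) :
      corotating Ω x u = u.2.2 - (u.1 * Ω) • axialField x := by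
    simp [corotating, smul_smul]
  rw [← h, ← h]
  simp only [wormholeForm, add_apply, smul_apply,
    pullbackForm_apply, smul_eq_mul, ContinuousLinearMap.mul_apply']
  rfl

theorem wormholeForm_comm (N R Ω : ℝ) (x : EuclideanSpace ℝ (Fin 3))
    (v w : ℝ × ℝ × EuclideanSpace ℝ (Fin 3)) :
    wormholeForm N R Ω x v w = wormholeForm N R Ω x w v := by
  rw [wormholeForm_apply, wormholeForm_apply, real_inner_comm, mul_comm v.1, mul_comm v.2.1]

theorem wormholeForm_pos {N R : ℝ} (hR : 0 < R) (Ω : ℝ) (x : EuclideanSpace ℝ (Fin 3))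
    (v : ℝ × ℝ × EuclideanSpace ℝ (Fin 3)) (hv : v ≠ 0) (h0 : v.1 = 0) :
    0 < wormholeForm N R Ω x v v := by
  obtain ⟨τ, l, ξ⟩ := v
  simp only at h0
  subst h0
  rw [wormholeForm_apply]
  simp only [mul_zero, zero_mul, zero_smul, sub_zero, zero_add, real_inner_self_eq_norm_sq]
  by_cases hl : l = 0
  · have hξ : ξ ≠ 0 := by
      rintro rfl
      exact hv (by simp [hl])
    have := norm_pos_iff.mpr hξ
    positivity
  · have : 0 < l * l := mul_self_pos.mpr hl
    positivity

theorem contDiff_wormholeForm :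
    ContDiff ℝ ∞ (fun q : ℝ × ℝ × ℝ × EuclideanSpace ℝ (Fin 3) ↦
      wormholeForm q.1 q.2.1 q.2.2.1 q.2.2.2) := by
  have hK : ContDiff ℝ ∞ axialField := by
    rw [contDiff_euclidean]
    intro i
    fin_cases i <;> simp [axialField] <;> fun_prop
  refine contDiff_clm_apply_iff.mpr fun v ↦ contDiff_clm_apply_iff.mpr fun w ↦ ?_
  simp only [wormholeForm_apply]
  have hK' : ContDiff ℝ ∞ (fun q : ℝ × ℝ × ℝ × EuclideanSpace ℝ (Fin 3) ↦ axialField q.2.2.2) :=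
    hK.comp (by fun_prop)
  have h (u : ℝ × ℝ × EuclideanSpace ℝ (Fin 3)) :
      ContDiff ℝ ∞ (fun q : ℝ × ℝ × ℝ × EuclideanSpace ℝ (Fin 3) ↦
        u.2.2 - (u.1 * q.2.2.1) • axialField q.2.2.2) := by
    have h1 : ContDiff ℝ ∞ (fun q : ℝ × ℝ × ℝ × EuclideanSpace ℝ (Fin 3) ↦ u.1 * q.2.2.1) := by
      fun_prop
    exact contDiff_const.sub (h1.smul hK')
  have h' := (h v).inner ℝ (h w)
  fun_prop

/-- At the point `x = (sin ϑ cos φ, sin ϑ sin φ, cos ϑ)` and on the vector with components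
`(τ, l, a, b)` with respect to `(t, ℓ, ϑ, φ)`, the form `wormholeForm` takes the value
`-N² τ² + l² + R² (a² + sin² ϑ (b - Ω τ)²)`. -/
theorem wormholeForm_spherical (N R Ω ϑ φ τ l a b : ℝ) :
    let x : EuclideanSpace ℝ (Fin 3) :=
      !₂[Real.sin ϑ * Real.cos φ, Real.sin ϑ * Real.sin φ, Real.cos ϑ]
    let v : ℝ × ℝ × EuclideanSpace ℝ (Fin 3) := (τ, l,
      a • !₂[Real.cos ϑ * Real.cos φ, Real.cos ϑ * Real.sin φ, -Real.sin ϑ] +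
        b • !₂[-(Real.sin ϑ * Real.sin φ), Real.sin ϑ * Real.cos φ, 0])
    wormholeForm N R Ω x v v = -N ^ 2 * τ ^ 2 + l ^ 2 +
      R ^ 2 * (a ^ 2 + Real.sin ϑ ^ 2 * (b - Ω * τ) ^ 2) := by
  intro x v
  rw [wormholeForm_apply, real_inner_self_eq_norm_sq, EuclideanSpace.norm_sq_eq]
  simp only [x, v, axialField, Fin.sum_univ_three, Real.norm_eq_abs, sq_abs]
  simp
  have h1 := Real.sin_sq_add_cos_sq ϑ
  have h2 := Real.sin_sq_add_cos_sq φ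
  have h3 : Real.cos ϑ ^ 2 = 1 - Real.sin ϑ ^ 2 := by linarith
  have h4 : Real.cos φ ^ 2 = 1 - Real.sin φ ^ 2 := by linarith
  ring_nf
  simp only [h3, h4]
  ring

/-- The inclusion of `ℝ × ℝ × S²` in `ℝ × ℝ × ℝ³`. -/
def wormholeInclusion (p : WormholeManifold) : ℝ × ℝ × EuclideanSpace ℝ (Fin 3) :=
  (p.1, p.2.1, p.2.2.1)

theorem contMDiff_wormholeInclusion :
    ContMDiff wormholeModel 𝓘(ℝ, ℝ × ℝ × EuclideanSpace ℝ (Fin 3)) ∞ wormholeInclusion := by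
  unfold wormholeInclusion
  refine ContMDiff.prodMk_space contMDiff_fst (ContMDiff.prodMk_space ?_ ?_)
  · exact contMDiff_fst.comp contMDiff_snd
  · exact contMDiff_coe_sphere.comp (contMDiff_snd.comp contMDiff_snd)

theorem hasMFDerivAt_prodMk_space {E : Type*} [NormedAddCommGroup E] [NormedSpace ℝ E]
    {H : Type*} [TopologicalSpace H] {I : ModelWithCorners ℝ E H}
    {M : Type*} [TopologicalSpace M] [ChartedSpace H M]
    {V₁ V₂ : Type*} [NormedAddCommGroup V₁] [NormedSpace ℝ V₁] [NormedAddCommGroup V₂]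
    [NormedSpace ℝ V₂] {f : M → V₁} {g : M → V₂} {p : M}
    {df : TangentSpace I p →L[ℝ] V₁} {dg : TangentSpace I p →L[ℝ] V₂}
    (hf : HasMFDerivAt I 𝓘(ℝ, V₁) f p df) (hg : HasMFDerivAt I 𝓘(ℝ, V₂) g p dg) :
    HasMFDerivAt I 𝓘(ℝ, V₁ × V₂) (fun y ↦ (f y, g y)) p (df.prod dg) :=
  ⟨hf.1.prodMk hg.1, hf.2.prodMk hg.2⟩

theorem mvfderiv_wormholeInclusion (p : WormholeManifold) (v : TangentSpace wormholeModel p) :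
    mvfderiv wormholeModel wormholeInclusion p v =
      (v.1, v.2.1, mvfderiv (𝓡 2) (fun x : Sphere2 ↦ x.1) p.2.2 v.2.2) := by
  have hx : MDifferentiableAt (𝓡 2) 𝓘(ℝ, EuclideanSpace ℝ (Fin 3)) (fun x : Sphere2 ↦ x.1) p.2.2 :=
    (contMDiff_coe_sphere (m := 1) p.2.2).mdifferentiableAt one_ne_zero
  have h1 : HasMFDerivAt wormholeModel 𝓘(ℝ, ℝ) (fun q : WormholeManifold ↦ q.1) p
      (ContinuousLinearMap.fst ℝ ℝ (ℝ × EuclideanSpace ℝ (Fin 2))) := hasMFDerivAt_fst p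
  have h2 : HasMFDerivAt wormholeModel (𝓘(ℝ, ℝ).prod (𝓡 2)) (fun q : WormholeManifold ↦ q.2) p
      (ContinuousLinearMap.snd ℝ ℝ (ℝ × EuclideanSpace ℝ (Fin 2))) := hasMFDerivAt_snd p
  have h21 := (hasMFDerivAt_fst (I := 𝓘(ℝ, ℝ)) (I' := 𝓡 2) p.2).comp p h2
  have h22 := (hasMFDerivAt_snd (I := 𝓘(ℝ, ℝ)) (I' := 𝓡 2) p.2).comp p h2
  have h3 := HasMFDerivAt.comp p hx.hasMFDerivAt h22
  have h := hasMFDerivAt_prodMk_space h1 (hasMFDerivAt_prodMk_space h21 h3)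
  have h' := h.mfderiv
  change (mfderiv wormholeModel 𝓘(ℝ, ℝ × ℝ × EuclideanSpace ℝ (Fin 3)) wormholeInclusion p) v = _
  rw [show mfderiv wormholeModel 𝓘(ℝ, ℝ × ℝ × EuclideanSpace ℝ (Fin 3)) wormholeInclusion p = _
    from h']
  rfl

theorem mvfderiv_time (p : WormholeManifold) (v : TangentSpace wormholeModel p) :
    mvfderiv wormholeModel (fun q : WormholeManifold ↦ q.1) p v = v.1 := by
  have h1 : HasMFDerivAt wormholeModel 𝓘(ℝ, ℝ) (fun q : WormholeManifold ↦ q.1) p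
      (ContinuousLinearMap.fst ℝ ℝ (ℝ × EuclideanSpace ℝ (Fin 2))) := hasMFDerivAt_fst p
  change (mfderiv wormholeModel 𝓘(ℝ, ℝ) (fun q : WormholeManifold ↦ q.1) p) v = _
  rw [h1.mfderiv]
  rfl

namespace WormholeCoefficients

variable (W : WormholeCoefficients)

/-- The lapse as a function on spacetime. -/
def lapse (p : WormholeManifold) : ℝ := W.N p.2.1 (colatitude p.2.2)

/-- The function `R` on spacetime. -/
def radius (p : WormholeManifold) : ℝ := W.R p.2.1 (colatitude p.2.2)

/-- The function `Ω` on spacetime. -/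
def twist (p : WormholeManifold) : ℝ := W.Ω p.2.1 (colatitude p.2.2)

/-- The metric `-N² dt² + dℓ² + R² (dϑ² + sin² ϑ (dφ - Ω dt)²)` on `ℝ × ℝ × S²`. -/
def metric (p : WormholeManifold) :
    TangentSpace wormholeModel p →L[ℝ] TangentSpace wormholeModel p →L[ℝ] ℝ :=
  pullbackForm (wormholeForm (W.lapse p) (W.radius p) (W.twist p) p.2.2.1)
    (mvfderiv wormholeModel wormholeInclusion p)

theorem lapse_pos (p : WormholeManifold) : 0 < W.lapse p :=
  W.N_pos _ _ ⟨Real.arccos_nonneg _, Real.arccos_le_pi _⟩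

theorem radius_pos (p : WormholeManifold) : 0 < W.radius p :=
  W.R_pos _ _ ⟨Real.arccos_nonneg _, Real.arccos_le_pi _⟩

theorem contMDiff_lapse : ContMDiff wormholeModel 𝓘(ℝ, ℝ) ∞ W.lapse :=
  W.smooth_N.comp contMDiff_snd

theorem contMDiff_radius : ContMDiff wormholeModel 𝓘(ℝ, ℝ) ∞ W.radius :=
  W.smooth_R.comp contMDiff_snd

theorem contMDiff_twist : ContMDiff wormholeModel 𝓘(ℝ, ℝ) ∞ W.twist :=
  W.smooth_Ω.comp contMDiff_snd

theorem contMDiff_form : ContMDiff wormholeModel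
    𝓘(ℝ, (ℝ × ℝ × EuclideanSpace ℝ (Fin 3)) →L[ℝ]
      (ℝ × ℝ × EuclideanSpace ℝ (Fin 3)) →L[ℝ] ℝ) ∞
    (fun p ↦ wormholeForm (W.lapse p) (W.radius p) (W.twist p) p.2.2.1) := by
  have hx : ContMDiff wormholeModel 𝓘(ℝ, EuclideanSpace ℝ (Fin 3)) ∞
      (fun p : WormholeManifold ↦ p.2.2.1) :=
    contMDiff_coe_sphere.comp (contMDiff_snd.comp contMDiff_snd)
  have h : ContMDiff wormholeModel 𝓘(ℝ, ℝ × ℝ × ℝ × EuclideanSpace ℝ (Fin 3)) ∞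
      (fun p : WormholeManifold ↦ (W.lapse p, W.radius p, W.twist p, p.2.2.1)) :=
    W.contMDiff_lapse.prodMk_space
      (W.contMDiff_radius.prodMk_space (W.contMDiff_twist.prodMk_space hx))
  intro p
  exact ContDiffAt.comp_contMDiffAt
    (g := fun q : ℝ × ℝ × ℝ × EuclideanSpace ℝ (Fin 3) ↦ wormholeForm q.1 q.2.1 q.2.2.1 q.2.2.2)
    (f := fun p : WormholeManifold ↦ (W.lapse p, W.radius p, W.twist p, p.2.2.1))
    contDiff_wormholeForm.contDiffAt (h p)

theorem metric_apply (p : WormholeManifold) (v w : TangentSpace wormholeModel p) :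
    W.metric p v w = wormholeForm (W.lapse p) (W.radius p) (W.twist p) p.2.2.1
      (v.1, v.2.1, mvfderiv (𝓡 2) (fun x : Sphere2 ↦ x.1) p.2.2 v.2.2)
      (w.1, w.2.1, mvfderiv (𝓡 2) (fun x : Sphere2 ↦ x.1) p.2.2 w.2.2) := by
  simp only [metric, pullbackForm_apply, mvfderiv_wormholeInclusion]

theorem metric_pos_of_time_eq_zero (p : WormholeManifold) (v : TangentSpace wormholeModel p)
    (hv : v ≠ 0) (h0 : v.1 = 0) : 0 < W.metric p v v := by
  rw [metric_apply]
  refine wormholeForm_pos (W.radius_pos p) _ _ _ (fun h ↦ hv ?_) h0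
  have h2 : v.2.1 = 0 := congrArg (fun u ↦ u.2.1) h
  have h3 : mvfderiv (𝓡 2) (fun x : Sphere2 ↦ x.1) p.2.2 v.2.2 = 0 := congrArg (fun u ↦ u.2.2) h
  have h4 : v.2.2 = 0 := injective_mvfderiv_subtypeVal_sphere p.2.2 (h3.trans (map_zero _).symm)
  exact Prod.ext h0 (Prod.ext h2 h4)

theorem metric_signature (p : WormholeManifold) : ∃ u : TangentSpace wormholeModel p,
    W.metric p u u < 0 ∧
      ∀ v : TangentSpace wormholeModel p, W.metric p u v = 0 → v ≠ 0 → 0 < W.metric p v v := by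
  have hK : axialField p.2.2.1 ∈
      (mvfderiv (𝓡 2) (fun x : Sphere2 ↦ x.1) p.2.2).range := by
    rw [range_mvfderiv_subtypeVal, Submodule.mem_orthogonal_singleton_iff_inner_right]
    simp [axialField, PiLp.inner_apply, Fin.sum_univ_three]
    ring
  obtain ⟨k, hk⟩ := hK
  have hk' : mvfderiv (𝓡 2) (fun x : Sphere2 ↦ x.1) p.2.2 k = axialField p.2.2.1 := hk
  have hN := W.lapse_pos p
  let u : TangentSpace wormholeModel p := ((1 : ℝ), (0 : ℝ), W.twist p • k)
  have key (v : TangentSpace wormholeModel p) : W.metric p u v = -(W.lapse p) ^ 2 * v.1 := by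
    rw [metric_apply, wormholeForm_apply]
    have : mvfderiv (𝓡 2) (fun x : Sphere2 ↦ x.1) p.2.2 u.2.2 =
        W.twist p • axialField p.2.2.1 := by
      rw [← hk']
      exact map_smul _ _ _
    rw [this]
    simp [u]
  refine ⟨u, ?_, fun v h hv ↦ W.metric_pos_of_time_eq_zero p v hv ?_⟩
  · rw [key]
    simp only [u]
    nlinarith [sq_pos_of_pos hN]
  · rw [key] at h
    have h1 : -(W.lapse p) ^ 2 ≠ 0 := by
      have := sq_pos_of_pos hN
      linarith
    exact (mul_eq_zero.mp h).resolve_left h1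

/-- The wormhole spacetime: `ℝ × ℝ × S²` with the wormhole metric, time-oriented by `dt`. -/
def spacetime : SpacetimeStructure wormholeModel WormholeManifold where
  inner := W.metric
  symm p v w := by
    rw [metric_apply, metric_apply]
    exact wormholeForm_comm ..
  signature := W.metric_signature
  contMDiff := contMDiff_pullbackForm contMDiff_wormholeInclusion W.contMDiff_form
  timeForm p := mvfderiv wormholeModel (fun q : WormholeManifold ↦ q.1) p
  timeForm_ne_zero p v hv hc h0 := by
    rw [mvfderiv_time] at h0
    exact absurd (W.metric_pos_of_time_eq_zero p v hv h0) (not_lt.mpr hc)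
  timeForm_continuous := continuous_mvfderiv contMDiff_fst

end WormholeCoefficients

end

/-! ### Differential inequalities off a locally finite set -/

/-! The slice `t = 0` is a Cauchy hypersurface, because no causal curve can run off to infinity in
finite coordinate time. For a future causal velocity `(τ, l, ξ)` the metric gives `|l| ≤ N τ` and `R
|ξ - Ω τ ∂_φ| ≤ N τ`. The asymptotics for large `|ℓ|`, together with compactness of the remaining
part of `ℝ × S²`, bound `N`, `1/R` and `|Ω|` globally. Hence the whole curve is Lipschitz with
respect to `t`, with one constant for all causal curves (`exists_dist_le_of_isFutureCausalCurve`).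

If `t` had a finite limit at one end of the curve, the curve would be Cauchy there and would
converge, since `ℝ × ℝ × S²` is complete (`exists_tendsto_of_dist_le_mul_dist`). On an inextendible
curve, `t` therefore increases strictly from `-∞` to `∞` and vanishes exactly once. -/

/-- An exceptional point inside the interval splits it into two pieces, each with one exception
fewer. Once none is left, continuity up to the endpoints and a positive derivative inside suffice.
The endpoints are quantified after `S` so that the induction hypothesis applies to both pieces. -/
theorem lt_of_hasDerivAt_pos_off_finite {f f' : ℝ → ℝ} (hf : Continuous f) {S : Set ℝ}
    (hS : S.Finite) : ∀ {a b : ℝ}, a < b → (∀ s ∈ Ioo a b, s ∉ S → HasDerivAt f (f' s) s) →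
      (∀ s ∈ Ioo a b, s ∉ S → 0 < f' s) → f a < f b := by
  induction S, hS using Set.Finite.induction_on with
  | empty =>
    intro a b hab hd hpos
    refine strictMonoOn_of_deriv_pos (convex_Icc a b) hf.continuousOn (fun s hs ↦ ?_)
      (left_mem_Icc.mpr hab.le) (right_mem_Icc.mpr hab.le) hab
    rw [interior_Icc] at hs
    rw [(hd s hs (notMem_empty s)).deriv]
    exact hpos s hs (notMem_empty s)
  | @insert c S _ _ ih =>
    intro a b hab hd hpos
    by_cases hc : c ∈ Ioo a b
    · have h1 : f a < f c := ih hc.1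
        (fun s hs hsS ↦ hd s ⟨hs.1, hs.2.trans hc.2⟩ (by simp [hs.2.ne, hsS]))
        (fun s hs hsS ↦ hpos s ⟨hs.1, hs.2.trans hc.2⟩ (by simp [hs.2.ne, hsS]))
      have h2 : f c < f b := ih hc.2
        (fun s hs hsS ↦ hd s ⟨hc.1.trans hs.1, hs.2⟩ (by simp [hs.1.ne', hsS]))
        (fun s hs hsS ↦ hpos s ⟨hc.1.trans hs.1, hs.2⟩ (by simp [hs.1.ne', hsS]))
      exact h1.trans h2
    · have hne (s : ℝ) (hs : s ∈ Ioo a b) : s ≠ c := fun h ↦ hc (h ▸ hs)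
      exact ih hab (fun s hs hsS ↦ hd s hs (by simp [hne s hs, hsS]))
        (fun s hs hsS ↦ hpos s hs (by simp [hne s hs, hsS]))

theorem strictMono_of_hasDerivAt_pos_off {f f' : ℝ → ℝ} (hf : Continuous f) {B : Set ℝ}
    (hB : ∀ a b : ℝ, (B ∩ Icc a b).Finite) (hd : ∀ s ∉ B, HasDerivAt f (f' s) s)
    (hpos : ∀ s ∉ B, 0 < f' s) : StrictMono f := fun a b hab ↦
  lt_of_hasDerivAt_pos_off_finite hf (hB a b) hab
    (fun s hs h ↦ hd s fun hsB ↦ h ⟨hsB, Ioo_subset_Icc_self hs⟩)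
    (fun s hs h ↦ hpos s fun hsB ↦ h ⟨hsB, Ioo_subset_Icc_self hs⟩)

/-- If `‖f'‖ < C t'` off a locally finite set, then `f` is `C`-Lipschitz with respect to `t`. -/
theorem dist_le_mul_dist_of_norm_deriv_lt_off {V : Type*} [NormedAddCommGroup V]
    [InnerProductSpace ℝ V] {f f' : ℝ → V} {t t' : ℝ → ℝ} {C : ℝ} (hC : 0 ≤ C)
    (hf : Continuous f) (ht : Continuous t) {B : Set ℝ} (hB : ∀ a b : ℝ, (B ∩ Icc a b).Finite)
    (hdf : ∀ s ∉ B, HasDerivAt f (f' s) s) (hdt : ∀ s ∉ B, HasDerivAt t (t' s) s)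
    (h : ∀ s ∉ B, ‖f' s‖ < C * t' s) (a b : ℝ) :
    dist (f a) (f b) ≤ C * dist (t a) (t b) := by
  wlog hab : a ≤ b generalizing a b
  · rw [dist_comm, dist_comm (t a)]
    exact this b a (not_le.mp hab).le
  set v := f b - f a with hv
  rw [dist_comm, dist_eq_norm, ← hv]
  by_cases hv0 : v = 0
  · rw [hv0, norm_zero]; positivity
  have hvp : 0 < ‖v‖ := norm_pos_iff.mpr hv0
  -- Projecting onto the fixed chord `v` reduces the estimate to a scalar one: by Cauchy–Schwarz the
  -- derivative of this function is positive. Comparing its values at `a` and `b` gives `‖v‖² ≤ ‖v‖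
  -- C (t b - t a)`.
  have hmono : StrictMono fun s ↦ ‖v‖ * (C * t s) - inner ℝ v (f s) := by
    refine strictMono_of_hasDerivAt_pos_off (f' := fun s ↦ ‖v‖ * (C * t' s) - inner ℝ v (f' s))
      (by fun_prop) hB (fun s hs ↦ ?_) (fun s hs ↦ ?_)
    · have h1 := ((hasDerivAt_const s v).inner ℝ (hdf s hs))
      simp only [inner_zero_left, add_zero] at h1
      exact (((hdt s hs).const_mul C).const_mul ‖v‖).sub h1
    · have h1 := real_inner_le_norm v (f' s)
      have h2 := mul_lt_mul_of_pos_left (h s hs) hvp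
      linarith
  have h1 := hmono.monotone hab
  have h2 : inner ℝ v (f b) - inner ℝ v (f a) = ‖v‖ * ‖v‖ := by
    rw [← inner_sub_right, ← hv, real_inner_self_eq_norm_mul_norm]
  have h3 : ‖v‖ * ‖v‖ ≤ ‖v‖ * (C * (t b - t a)) := by linarith
  have h4 := le_of_mul_le_mul_left h3 hvp
  refine h4.trans (mul_le_mul_of_nonneg_left ?_ hC)
  rw [dist_comm, Real.dist_eq]
  exact le_abs_self _

/-- Convergence of `t` forces `dist (t a) (t b) → 0` along `l ×ˢ l`, so `F` is Cauchy along `l`. -/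
theorem exists_tendsto_of_dist_le_mul_dist {ι X Y : Type*} [PseudoMetricSpace X]
    [PseudoMetricSpace Y] [CompleteSpace X] {l : Filter ι} [l.NeBot] {F : ι → X} {t : ι → Y}
    {C : ℝ} (h : ∀ a b, dist (F a) (F b) ≤ C * dist (t a) (t b)) {y : Y}
    (ht : Tendsto t l (𝓝 y)) : ∃ p, Tendsto F l (𝓝 p) := by
  refine cauchy_map_iff_exists_tendsto.mp (cauchy_map_iff.mpr ⟨inferInstance, ?_⟩)
  have h1 : Tendsto (fun q : ι × ι ↦ C * dist (t q.1) (t q.2)) (l ×ˢ l) (𝓝 0) := by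
    have := (((ht.comp tendsto_fst).dist (ht.comp tendsto_snd)).const_mul C :
      Tendsto (fun q : ι × ι ↦ C * dist (t q.1) (t q.2)) (l ×ˢ l) _)
    simpa using this
  rw [Metric.uniformity_eq_comap_nhds_zero, tendsto_comap_iff]
  exact squeeze_zero (fun _ ↦ dist_nonneg) (fun q ↦ h q.1 q.2) h1

/-! ### Bounds on the metric coefficients -/

theorem colatitude_mem_Icc (x : Sphere2) : colatitude x ∈ Icc 0 Real.pi :=
  ⟨Real.arccos_nonneg _, Real.arccos_le_pi _⟩

/-- The asymptotic bound holds for `ℓ` outside some compact `K`, and on the compact set `K × S²`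
continuity gives a bound. -/
theorem exists_upper_bound_of_eventually {f : ℝ → ℝ → ℝ} {c : ℝ}
    (hf : Continuous fun y : ℝ × Sphere2 ↦ f y.1 (colatitude y.2))
    (hc : ∀ᶠ y : ℝ × ℝ in cocompact ℝ ×ˢ 𝓟 (Icc 0 Real.pi), f y.1 y.2 ≤ c) :
    ∃ C, ∀ ℓ x, f ℓ (colatitude x) ≤ C := by
  rw [Filter.Eventually, mem_prod_principal, mem_cocompact] at hc
  obtain ⟨K, hK, hKc⟩ := hc
  obtain ⟨C, hC⟩ := (hK.prod (isCompact_univ (X := Sphere2))).bddAbove_image hf.continuousOn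
  refine ⟨max C c, fun ℓ x ↦ ?_⟩
  by_cases hℓ : ℓ ∈ K
  · exact le_max_of_le_left (hC ⟨(ℓ, x), ⟨hℓ, mem_univ x⟩, rfl⟩)
  · exact le_max_of_le_right (hKc hℓ _ (colatitude_mem_Icc x))

theorem eventually_le_abs_fst (c : ℝ) :
    ∀ᶠ y : ℝ × ℝ in cocompact ℝ ×ˢ 𝓟 (Icc 0 Real.pi), c ≤ |y.1| :=
  ((tendsto_norm_cocompact_atTop (E := ℝ)).comp tendsto_fst).eventually_ge_atTop c

namespace WormholeCoefficients

variable (W : WormholeCoefficients)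

theorem exists_lapse_le : ∃ C, ∀ p, W.lapse p ≤ C := by
  obtain ⟨c, hc0, hc⟩ := W.asymp_N.exists_nonneg
  obtain ⟨C, hC⟩ := exists_upper_bound_of_eventually (f := W.N) (c := 1 + c)
    W.smooth_N.continuous (by
      filter_upwards [hc.bound, eventually_le_abs_fst 1] with y hy h1
      rw [Real.norm_eq_abs, Real.norm_eq_abs, abs_of_nonneg (a := 1 / |y.1|) (by positivity)] at hy
      have h2 : 1 / |y.1| ≤ 1 := (div_le_one (by linarith)).mpr h1
      have h3 := le_abs_self (W.N y.1 y.2 - 1)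
      nlinarith)
  exact ⟨C, fun p ↦ hC p.2.1 p.2.2⟩

theorem exists_inv_radius_le : ∃ C, ∀ p, (W.radius p)⁻¹ ≤ C := by
  obtain ⟨c, hc0, hc⟩ := W.asymp_R.exists_nonneg
  obtain ⟨C, hC⟩ := exists_upper_bound_of_eventually (f := fun ℓ ϑ ↦ (W.R ℓ ϑ)⁻¹) (c := 1)
    (W.smooth_R.continuous.inv₀ fun y ↦ (W.R_pos y.1 _ (colatitude_mem_Icc y.2)).ne') (by
      -- The asymptotics give `R ≥ |ℓ| - c`, so `|ℓ| ≥ 1 + c` ensures `R ≥ 1`.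
      filter_upwards [hc.bound, eventually_le_abs_fst (1 + c)] with y hy h1
      rw [Real.norm_eq_abs, Real.norm_eq_abs, abs_of_nonneg (a := 1 / |y.1|) (by positivity)] at hy
      have h2 : 0 < |y.1| := by linarith
      have h3 := (abs_le.mp hy).1
      have h4 : |y.1| - c ≤ W.R y.1 y.2 := by
        have h5 := mul_le_mul_of_nonneg_right h3 h2.le
        have h6 : -(c * (1 / |y.1|)) * |y.1| = -c := by field_simp
        have h7 : (W.R y.1 y.2 / |y.1| - 1) * |y.1| = W.R y.1 y.2 - |y.1| := by field_simp
        rw [h6, h7] at h5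
        linarith
      exact inv_le_one_of_one_le₀ (by linarith))
  exact ⟨C, fun p ↦ hC p.2.1 p.2.2⟩

theorem exists_abs_twist_le : ∃ C, ∀ p, |W.twist p| ≤ C := by
  obtain ⟨c, hc0, hc⟩ := W.asymp_Ω.exists_nonneg
  obtain ⟨C, hC⟩ := exists_upper_bound_of_eventually (f := fun ℓ ϑ ↦ |W.Ω ℓ ϑ|) (c := c)
    W.smooth_Ω.continuous.abs (by
      filter_upwards [hc.bound, eventually_le_abs_fst 1] with y hy h1
      rw [Real.norm_eq_abs, Real.norm_eq_abs, abs_of_nonneg (a := 1 / |y.1| ^ 2) (by positivity)] at hy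
      have h2 : 1 / |y.1| ^ 2 ≤ 1 := (div_le_one (by positivity)).mpr (one_le_pow₀ h1)
      nlinarith)
  exact ⟨C, fun p ↦ hC p.2.1 p.2.2⟩

end WormholeCoefficients

/-! ### The causal cone -/

theorem norm_axialField_le (x : EuclideanSpace ℝ (Fin 3)) : ‖axialField x‖ ≤ ‖x‖ := by
  rw [EuclideanSpace.norm_eq, EuclideanSpace.norm_eq]
  refine Real.sqrt_le_sqrt ?_
  simp only [axialField, Fin.sum_univ_three, Real.norm_eq_abs, sq_abs]
  simp
  nlinarith [sq_nonneg (x 2)]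

theorem abs_le_of_wormholeForm_nonpos {N R Ω : ℝ} {x : EuclideanSpace ℝ (Fin 3)}
    {v : ℝ × ℝ × EuclideanSpace ℝ (Fin 3)} (hN : 0 < N) (hv : 0 < v.1)
    (h : wormholeForm N R Ω x v v ≤ 0) : |v.2.1| ≤ N * v.1 := by
  rw [wormholeForm_apply, real_inner_self_eq_norm_sq] at h
  refine abs_le_of_sq_le_sq ?_ (by positivity)
  nlinarith [sq_nonneg (R * ‖v.2.2 - (v.1 * Ω) • axialField x‖)]

/-- The cone controls only the velocity `w` relative to the rotating frame, by `R ‖w‖ ≤ N τ`.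
Returning to `ξ` adds the frame dragging `Ω τ ∂_φ`, of length at most `|Ω| τ` on the unit sphere. -/
theorem norm_le_of_wormholeForm_nonpos {N R Ω : ℝ} {x : EuclideanSpace ℝ (Fin 3)}
    {v : ℝ × ℝ × EuclideanSpace ℝ (Fin 3)} (hN : 0 < N) (hR : 0 < R) (hx : ‖x‖ = 1) (hv : 0 < v.1)
    (h : wormholeForm N R Ω x v v ≤ 0) : ‖v.2.2‖ ≤ (N * R⁻¹ + |Ω|) * v.1 := by
  rw [wormholeForm_apply, real_inner_self_eq_norm_sq] at h
  set w := v.2.2 - (v.1 * Ω) • axialField x with hw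
  have h1 : R * ‖w‖ ≤ N * v.1 := by
    refine le_of_sq_le_sq ?_ (by positivity)
    nlinarith [sq_nonneg v.2.1]
  have h2 : ‖w‖ ≤ N * R⁻¹ * v.1 := by
    have : N * R⁻¹ * v.1 = N * v.1 / R := by field_simp
    rw [this, le_div_iff₀ hR]
    linarith
  have h3 : ‖(v.1 * Ω) • axialField x‖ ≤ |Ω| * v.1 := by
    rw [norm_smul, Real.norm_eq_abs, abs_mul, abs_of_pos hv, mul_comm v.1]
    exact mul_le_of_le_one_right (by positivity) (hx ▸ norm_axialField_le x)
  have h4 : v.2.2 = w + (v.1 * Ω) • axialField x := by rw [hw]; abel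
  rw [h4]
  refine (norm_add_le _ _).trans ?_
  linarith

/-- Passing to the ambient vector space turns manifold velocities into ordinary derivatives, whose
components can then be estimated separately. -/
theorem hasDerivAt_wormholeInclusion_comp {γ : ℝ → WormholeManifold} {s : ℝ}
    (h : ContMDiffAt 𝓘(ℝ, ℝ) wormholeModel 1 γ s) :
    HasDerivAt (fun s ↦ wormholeInclusion (γ s))
      (mvfderiv wormholeModel wormholeInclusion (γ s)
        (mfderiv 𝓘(ℝ, ℝ) wormholeModel γ s (1 : ℝ))) s := by
  have h1 := (h.mdifferentiableAt one_ne_zero).hasMFDerivAt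
  have h2 := ((contMDiff_wormholeInclusion (γ s)).mdifferentiableAt (by simp)).hasMFDerivAt
  have h3 : HasFDerivAt (E := ℝ) (F := ℝ × ℝ × EuclideanSpace ℝ (Fin 3))
      (wormholeInclusion ∘ γ) ((mvfderiv wormholeModel wormholeInclusion (γ s)).comp
        (mfderiv 𝓘(ℝ, ℝ) wormholeModel γ s)) s := hasMFDerivAt_iff_hasFDerivAt.mp (h2.comp s h1)
  exact h3.hasDerivAt

/-! ### Causal curves are Lipschitz in time -/

namespace WormholeCoefficients

variable (W : WormholeCoefficients)

/-- Along future-directed causal curves `t` is strictly increasing and all coordinates are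
uniformly Lipschitz functions of `t`. -/
theorem exists_dist_le_of_isFutureCausalCurve :
    ∃ C : ℝ, ∀ γ : ℝ → WormholeManifold, W.spacetime.IsFutureCausalCurve γ →
      StrictMono (fun s ↦ (γ s).1) ∧
        ∀ a b, dist (γ a) (γ b) ≤ C * dist (γ a).1 (γ b).1 := by
  obtain ⟨N₀, hN₀⟩ := W.exists_lapse_le
  obtain ⟨R₀, hR₀⟩ := W.exists_inv_radius_le
  obtain ⟨Ω₀, hΩ₀⟩ := W.exists_abs_twist_le
  -- The three constants serve `t`, `ℓ` and the sphere component. Since `t' > 0`, the summands `+ 1`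
  -- turn the weak cone inequalities into the strict ones that the Lipschitz lemma requires.
  refine ⟨max 1 (max (N₀ + 1) (N₀ * R₀ + Ω₀ + 1)), fun γ ⟨hγ, B, hB, hd⟩ ↦ ?_⟩
  have hN₀' : 0 < N₀ := (W.lapse_pos (γ 0)).trans_le (hN₀ _)
  have hR₀' : 0 < R₀ := (inv_pos.mpr (W.radius_pos (γ 0))).trans_le (hR₀ _)
  have hΩ₀' : 0 ≤ Ω₀ := (abs_nonneg _).trans (hΩ₀ (γ 0))
  set u : ℝ → ℝ × ℝ × EuclideanSpace ℝ (Fin 3) := fun s ↦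
    mvfderiv wormholeModel wormholeInclusion (γ s)
      (mfderiv 𝓘(ℝ, ℝ) wormholeModel γ s (1 : ℝ)) with hu
  have hdu (s) (hs : s ∉ B) : HasDerivAt (fun s ↦ wormholeInclusion (γ s)) (u s) s :=
    hasDerivAt_wormholeInclusion_comp (hd s hs).1
  -- The metric is by definition a pullback along the inclusion, so causality is this inequality for
  -- the ambient velocity.
  have hcone (s) (hs : s ∉ B) : wormholeForm (W.lapse (γ s)) (W.radius (γ s)) (W.twist (γ s))
      (γ s).2.2.1 (u s) (u s) ≤ 0 := (hd s hs).2.2.1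
  have hpos (s) (hs : s ∉ B) : 0 < (u s).1 := by
    have h1 : 0 < mvfderiv wormholeModel (fun q : WormholeManifold ↦ q.1) (γ s)
      (mfderiv 𝓘(ℝ, ℝ) wormholeModel γ s (1 : ℝ)) := (hd s hs).2.2.2
    rw [mvfderiv_time] at h1
    simp only [hu, mvfderiv_wormholeInclusion]
    exact h1
  have hdt (s) (hs : s ∉ B) : HasDerivAt (fun s ↦ (γ s).1) (u s).1 s := by
    simpa [wormholeInclusion] using (hdu s hs).hasFDerivAt.fst.hasDerivAt
  have hd2 (s) (hs : s ∉ B) :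
      HasDerivAt (fun s ↦ (wormholeInclusion (γ s)).2) (u s).2 s := by
    simpa [wormholeInclusion] using (hdu s hs).hasFDerivAt.snd.hasDerivAt
  have hdl (s) (hs : s ∉ B) : HasDerivAt (fun s ↦ (γ s).2.1) (u s).2.1 s := by
    simpa [wormholeInclusion] using (hd2 s hs).hasFDerivAt.fst.hasDerivAt
  have hdx (s) (hs : s ∉ B) : HasDerivAt (fun s ↦ (γ s).2.2.1) (u s).2.2 s := by
    simpa [wormholeInclusion] using (hd2 s hs).hasFDerivAt.snd.hasDerivAt
  have hct : Continuous fun s ↦ (γ s).1 := by fun_prop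
  refine ⟨strictMono_of_hasDerivAt_pos_off hct hB hdt hpos, fun a b ↦ ?_⟩
  have hl := dist_le_mul_dist_of_norm_deriv_lt_off (f := fun s ↦ (γ s).2.1) (C := N₀ + 1)
    (by positivity) (by fun_prop) hct hB hdl hdt (fun s hs ↦ by
      have h1 := abs_le_of_wormholeForm_nonpos (W.lapse_pos _) (hpos s hs) (hcone s hs)
      have h2 := mul_le_mul_of_nonneg_right (hN₀ (γ s)) (hpos s hs).le
      rw [Real.norm_eq_abs]
      linarith [hpos s hs]) a b
  have hx := dist_le_mul_dist_of_norm_deriv_lt_off (f := fun s ↦ (γ s).2.2.1)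
    (C := N₀ * R₀ + Ω₀ + 1) (by positivity) (by fun_prop) hct hB hdx hdt (fun s hs ↦ by
      have h1 := norm_le_of_wormholeForm_nonpos (W.lapse_pos _) (W.radius_pos _)
        (norm_eq_of_mem_sphere (γ s).2.2) (hpos s hs) (hcone s hs)
      have h2 : W.lapse (γ s) * (W.radius (γ s))⁻¹ ≤ N₀ * R₀ :=
        mul_le_mul (hN₀ _) (hR₀ _) (inv_pos.mpr (W.radius_pos _)).le hN₀'.le
      have h3 := mul_le_mul_of_nonneg_right (add_le_add h2 (hΩ₀ (γ s))) (hpos s hs).le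
      linarith [hpos s hs]) a b
  have hD : 0 ≤ dist (γ a).1 (γ b).1 := dist_nonneg
  -- The product carries the maximum distance and the sphere the chordal distance of `ℝ³`, so the
  -- three estimates combine componentwise.
  rw [Prod.dist_eq, Prod.dist_eq, max_mul_of_nonneg _ _ hD, max_mul_of_nonneg _ _ hD, one_mul]
  exact max_le_max le_rfl (max_le_max hl hx)

end WormholeCoefficients

/-- Every rotating traversable wormhole spacetime is globally hyperbolic. -/
theorem mainTheorem3 (W : WormholeCoefficients) : W.spacetime.IsGloballyHyperbolic := by
  obtain ⟨C, hC⟩ := W.exists_dist_le_of_isFutureCausalCurve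
  refine ⟨{p | p.1 = 0}, isClosed_eq continuous_fst continuous_const, fun γ hγ hinext ↦ ?_⟩
  obtain ⟨hmono, hdist⟩ := hC γ hγ
  have hct : Continuous fun s ↦ (γ s).1 := continuous_fst.comp hγ.1
  -- A monotone function diverges or converges; convergence of `t` would give the curve an endpoint.
  have htop : Tendsto (fun s ↦ (γ s).1) atTop atTop :=
    (tendsto_atTop_of_monotone hmono.monotone).resolve_right fun ⟨_, hy⟩ ↦
      hinext.1 (exists_tendsto_of_dist_le_mul_dist hdist hy)
  have hbot : Tendsto (fun s ↦ (γ s).1) atBot atBot :=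
    (tendsto_atBot_of_monotone hmono.monotone).resolve_right fun ⟨_, hy⟩ ↦
      hinext.2 (exists_tendsto_of_dist_le_mul_dist hdist hy)
  obtain ⟨s, hs⟩ := hct.surjective htop hbot 0
  exact ⟨s, hs, fun r hr ↦ hmono.injective (Eq.trans hr hs.symm)⟩
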